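/- Let $\alpha\in(0,1)$. For a symmetric, finitely supported probability distribution $m$ on $\mathbb Z$ let $\beta(m)=\sup\{x\in\mathbb Z: m([x,\infty))\ge \alpha/2\}\ (\ge 0)$, and let $r_m$ be the rightmost mass $\alpha/2$ of $m$: $r_m(y)=m(y)$ for $y>\beta(m)$, $r_m(y)=\frac{\alpha}{2}-\sum_{z>\beta(m)}m(z)$ for $y=\beta(m)$, and $r_m(y)=0$ for $y<\beta(m)$. The frozen mass is $f_m(y)=r_m(y)+r_m(-y)$ and the free mass is $\nu_m=m-f_m$. Frozen-Boundary Diffusion-$\alpha$ is the sequence $(\mu_t)_{t\ge0}$ of symmetric, finitely supported probability distributions on $\mathbb Z$ given by $\mu_0=\delta(0)$ and $$\mu_{t+1}(x)=\frac{\nu_{\mu_t}(x-1)+\nu_{\mu_t}(x+1)}{2}+f_{\mu_t}(x),\qquad x\in\mathbb Z.$$ Put $\beta_t=\beta(\mu_t)$ and, for $t\ge1$, let $\tilde\mu_t$ be the Borel probability measure on $\mathbb R$ with $\tilde\mu_t(A)=\mu_t(\{y\sqrt t: y\in A\})$. Let $\Phi$ be the standard Gaussian measure on $\mathbb R$ and,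 for $q>0$, let $\Phi_q=\Phi(\,\cdot\,\cap[-q,q])/\Phi([-q,q])$. **Theorem.** There is a unique number $q_\alpha>0$ such that $$\frac{\alpha}{2}q_\alpha=\frac{(1-\alpha)e^{-q_\alpha^2/2}}{\sqrt{2\pi}\,\Phi([-q_\alpha,q_\alpha])},$$ and if $\beta_t/\sqrt t$ converges to some real constant as $t\to\infty$, then $$\tilde\mu_t\ \Longrightarrow\ \frac{\alpha}{2}\delta(-q_\alpha)+(1-\alpha)\Phi_{q_\alpha}+\frac{\alpha}{2}\delta(q_\alpha)$$ weakly as $t\to\infty$. -/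

import Mathlib

open MeasureTheory ProbabilityTheory Filter Topology

noncomputable section

namespace FBD

/-- The mass that a mass distribution `m` on `ℤ` gives to a set `s` of sites. -/
def massOf (m : ℤ → ℝ) (s : Set ℤ) : ℝ := ∑' z : s, m z

/-- The boundary of a mass distribution: `sup {x : m([x, ∞)) ≥ α / 2}`. -/
def boundary (α : ℝ) (m : ℤ → ℝ) : ℤ := sSup {x : ℤ | α / 2 ≤ massOf m (Set.Ici x)}

/-- The rightmost mass `α / 2` of `m`. -/
def rightFrozen (α : ℝ) (m : ℤ → ℝ) (y : ℤ) : ℝ :=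
  if boundary α m < y then m y
  else if y = boundary α m then α / 2 - massOf m (Set.Ioi (boundary α m))
  else 0

/-- The frozen mass: the rightmost mass `α / 2` together with its mirror image. At a site `y ≠ 0`
at most one of the two terms is nonzero (the boundary is never negative, see `boundary_nonneg`);
if the boundary is at the origin, then the two sides both contribute to the mass frozen there. -/
def frozen (α : ℝ) (m : ℤ → ℝ) (y : ℤ) : ℝ := rightFrozen α m y + rightFrozen α m (-y)

/-- The free mass. -/
def free (α : ℝ) (m : ℤ → ℝ) (y : ℤ) : ℝ := m y - frozen α m y

/-- One step of Frozen-Boundary Diffusion: the free mass at each site is split equally between the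
two neighbours, the frozen mass stays. -/
def step (α : ℝ) (m : ℤ → ℝ) (x : ℤ) : ℝ :=
  (free α m (x - 1) + free α m (x + 1)) / 2 + frozen α m x

/-- Frozen-Boundary Diffusion with parameter `α`: the mass distributions `μ_t` on `ℤ`, started from
the unit mass at the origin. -/
def mu (α : ℝ) : ℕ → ℤ → ℝ
  | 0 => fun x => if x = 0 then 1 else 0
  | t + 1 => step α (mu α t)

/-- The boundary location `β_t`. -/
def beta (α : ℝ) (t : ℕ) : ℤ := boundary α (mu α t)

/-- Symmetric, finitely supported probability distributions on `ℤ`. -/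
structure IsSymmProb (m : ℤ → ℝ) : Prop where
  finite : (Function.support m).Finite
  symm : ∀ x, m (-x) = m x
  nonneg : ∀ x, 0 ≤ m x
  total : ∑' x, m x = 1

theorem IsSymmProb.summable {m : ℤ → ℝ} (h : IsSymmProb m) : Summable m :=
  summable_of_hasFiniteSupport h.finite

theorem IsSymmProb.massOf_nonneg {m : ℤ → ℝ} (h : IsSymmProb m) (s : Set ℤ) : 0 ≤ massOf m s :=
  tsum_nonneg fun z => h.nonneg z

theorem IsSymmProb.massOf_union {m : ℤ → ℝ} (h : IsSymmProb m) {s t : Set ℤ}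
    (hst : Disjoint s t) : massOf m (s ∪ t) = massOf m s + massOf m t :=
  (h.summable.subtype s).tsum_union_disjoint hst (h.summable.subtype t)

theorem massOf_singleton (m : ℤ → ℝ) (x : ℤ) : massOf m {x} = m x := by
  simp [massOf]

theorem IsSymmProb.massOf_Ici {m : ℤ → ℝ} (h : IsSymmProb m) (x : ℤ) :
    massOf m (Set.Ici x) = m x + massOf m (Set.Ioi x) := by
  rw [← massOf_singleton m x, ← h.massOf_union (by simp)]
  congr 1
  ext z
  simp only [Set.mem_Ici, Set.mem_union, Set.mem_singleton_iff, Set.mem_Ioi]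
  omega

theorem IsSymmProb.massOf_Iio_zero {m : ℤ → ℝ} (h : IsSymmProb m) :
    massOf m (Set.Iio 0) = massOf m (Set.Ioi 0) := by
  unfold massOf
  rw [tsum_subtype, tsum_subtype, ← (Equiv.neg ℤ).tsum_eq]
  refine tsum_congr fun z => ?_
  simp [Set.indicator, h.symm]

theorem IsSymmProb.total_eq {m : ℤ → ℝ} (h : IsSymmProb m) :
    m 0 + 2 * massOf m (Set.Ioi 0) = 1 := by
  have h1 : massOf m (Set.Iio 0 ∪ Set.Ici 0) = 1 := by
    rw [Set.Iio_union_Ici]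
    unfold massOf
    rw [tsum_subtype]
    simpa using h.total
  rw [h.massOf_union (by
      rw [Set.disjoint_left]
      intro z hz hz'
      exact absurd (Set.mem_Ici.1 hz') (not_le.2 hz)), h.massOf_Ici, h.massOf_Iio_zero] at h1
  linarith

theorem IsSymmProb.zero_mem {α : ℝ} (hα : α < 1) {m : ℤ → ℝ} (h : IsSymmProb m) :
    (0 : ℤ) ∈ {x : ℤ | α / 2 ≤ massOf m (Set.Ici x)} := by
  have h1 := h.total_eq
  have h2 := h.massOf_Ici 0
  have h3 := h.nonneg 0
  simp only [Set.mem_ofPred_eq]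
  linarith

theorem IsSymmProb.bddAbove {α : ℝ} (hα : 0 < α) {m : ℤ → ℝ} (h : IsSymmProb m) :
    BddAbove {x : ℤ | α / 2 ≤ massOf m (Set.Ici x)} := by
  obtain ⟨N, hN⟩ := h.finite.bddAbove
  refine ⟨N, fun x hx => ?_⟩
  by_contra hlt
  have h0 : massOf m (Set.Ici x) = 0 := by
    unfold massOf
    rw [tsum_congr (g := fun _ => (0 : ℝ)), tsum_zero]
    intro z
    by_contra hz
    have h1 : (z : ℤ) ≤ N := hN hz
    have h2 : x ≤ z := z.2
    omega
  simp only [Set.mem_ofPred_eq, h0] at hx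
  linarith

theorem boundary_nonneg {α : ℝ} (hα : α ∈ Set.Ioo (0 : ℝ) 1) {m : ℤ → ℝ} (h : IsSymmProb m) :
    0 ≤ boundary α m :=
  le_csSup (h.bddAbove hα.1) (h.zero_mem hα.2)

theorem le_massOf_boundary {α : ℝ} (hα : α ∈ Set.Ioo (0 : ℝ) 1) {m : ℤ → ℝ}
    (h : IsSymmProb m) : α / 2 ≤ massOf m (Set.Ici (boundary α m)) :=
  Int.csSup_mem ⟨0, h.zero_mem hα.2⟩ (h.bddAbove hα.1)

theorem massOf_Ioi_boundary_lt {α : ℝ} (hα : α ∈ Set.Ioo (0 : ℝ) 1) {m : ℤ → ℝ}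
    (h : IsSymmProb m) : massOf m (Set.Ioi (boundary α m)) < α / 2 := by
  by_contra hle
  have h1 : boundary α m + 1 ≤ boundary α m := by
    refine le_csSup (h.bddAbove hα.1) ?_
    have h2 : Set.Ici (boundary α m + 1) = Set.Ioi (boundary α m) := by
      ext z
      simp only [Set.mem_Ici, Set.mem_Ioi]
      omega
    simp only [Set.mem_ofPred_eq, h2]
    exact not_lt.1 hle
  omega

theorem rightFrozen_nonneg {α : ℝ} (hα : α ∈ Set.Ioo (0 : ℝ) 1) {m : ℤ → ℝ}
    (h : IsSymmProb m) (y : ℤ) : 0 ≤ rightFrozen α m y := by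
  unfold rightFrozen
  have := massOf_Ioi_boundary_lt hα h
  split_ifs
  · exact h.nonneg y
  · linarith
  · exact le_rfl

theorem rightFrozen_le {α : ℝ} (hα : α ∈ Set.Ioo (0 : ℝ) 1) {m : ℤ → ℝ}
    (h : IsSymmProb m) (y : ℤ) : rightFrozen α m y ≤ m y := by
  unfold rightFrozen
  have h1 := le_massOf_boundary hα h
  rw [h.massOf_Ici] at h1
  split_ifs with h2 h3
  · exact le_rfl
  · rw [h3]
    linarith
  · exact h.nonneg y

theorem rightFrozen_of_neg {α : ℝ} (hα : α ∈ Set.Ioo (0 : ℝ) 1) {m : ℤ → ℝ}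
    (h : IsSymmProb m) {y : ℤ} (hy : y < 0) : rightFrozen α m y = 0 := by
  have := boundary_nonneg hα h
  unfold rightFrozen
  rw [if_neg (by omega), if_neg (by omega)]

theorem frozen_neg (α : ℝ) (m : ℤ → ℝ) (y : ℤ) : frozen α m (-y) = frozen α m y := by
  simp [frozen, add_comm]

theorem frozen_nonneg {α : ℝ} (hα : α ∈ Set.Ioo (0 : ℝ) 1) {m : ℤ → ℝ}
    (h : IsSymmProb m) (y : ℤ) : 0 ≤ frozen α m y :=
  add_nonneg (rightFrozen_nonneg hα h y) (rightFrozen_nonneg hα h (-y))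

theorem frozen_le {α : ℝ} (hα : α ∈ Set.Ioo (0 : ℝ) 1) {m : ℤ → ℝ}
    (h : IsSymmProb m) (y : ℤ) : frozen α m y ≤ m y := by
  unfold frozen
  rcases lt_trichotomy y 0 with hy | hy | hy
  · rw [rightFrozen_of_neg hα h hy, zero_add, ← h.symm]
    exact rightFrozen_le hα h _
  · subst hy
    rcases (boundary_nonneg hα h).lt_or_eq with hb | hb
    · have h0 : rightFrozen α m 0 = 0 := by
        unfold rightFrozen
        rw [if_neg (by omega), if_neg (by omega)]
      simpa [h0] using h.nonneg 0
    · have h0 : rightFrozen α m 0 = α / 2 - massOf m (Set.Ioi 0) := by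
        unfold rightFrozen
        rw [if_neg (by omega), if_pos hb, ← hb]
      have h1 := h.total_eq
      have h2 := hα.2
      rw [neg_zero, h0]
      linarith
  · rw [rightFrozen_of_neg hα h (y := -y) (by omega), add_zero]
    exact rightFrozen_le hα h _

theorem isSymmProb_step {α : ℝ} (hα : α ∈ Set.Ioo (0 : ℝ) 1) {m : ℤ → ℝ}
    (h : IsSymmProb m) : IsSymmProb (step α m) := by
  have hfz : (Function.support (frozen α m)).Finite := by
    refine h.finite.subset fun y hy hm => hy ?_
    exact le_antisymm ((frozen_le hα h y).trans_eq hm) (frozen_nonneg hα h y)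
  have hfr : (Function.support (free α m)).Finite :=
    (h.finite.union hfz).subset (Function.support_sub m (frozen α m))
  have hfrn : ∀ y, 0 ≤ free α m y := fun y => sub_nonneg.2 (frozen_le hα h y)
  have hm1 : (Function.support fun x => free α m (x - 1)).Finite :=
    hfr.preimage (Equiv.subRight (1 : ℤ)).injective.injOn
  have hp1 : (Function.support fun x => free α m (x + 1)).Finite :=
    hfr.preimage (add_left_injective (1 : ℤ)).injOn
  have sfr : Summable (free α m) := summable_of_hasFiniteSupport hfr
  have sfz : Summable (frozen α m) := summable_of_hasFiniteSupport hfz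
  have sm1 : Summable fun x => free α m (x - 1) := summable_of_hasFiniteSupport hm1
  have sp1 : Summable fun x => free α m (x + 1) := summable_of_hasFiniteSupport hp1
  refine ⟨?_, ?_, ?_, ?_⟩
  · refine ((hm1.union hp1).union hfz).subset fun x hx => ?_
    by_contra hn
    simp only [Set.mem_union, Function.mem_support, not_or, not_not] at hn
    exact hx (by simp [step, hn.1.1, hn.1.2, hn.2])
  · intro x
    have hs : ∀ y, free α m (-y) = free α m y := fun y => by
      simp [free, h.symm, frozen_neg]
    unfold step
    rw [frozen_neg, ← hs (-x - 1), ← hs (-x + 1)]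
    ring_nf
  · intro x
    have h1 := hfrn (x - 1)
    have h2 := hfrn (x + 1)
    have h3 := frozen_nonneg hα h x
    unfold step
    linarith
  · have e1 : ∑' x, free α m (x - 1) = ∑' x, free α m x :=
      (Equiv.subRight (1 : ℤ)).tsum_eq (free α m)
    have e2 : ∑' x, free α m (x + 1) = ∑' x, free α m x :=
      (Equiv.addRight (1 : ℤ)).tsum_eq (free α m)
    have e3 : ∑' x, m x = ∑' x, free α m x + ∑' x, frozen α m x := by
      rw [← sfr.tsum_add sfz]
      exact tsum_congr fun x => by simp [free]
    unfold step
    rw [((sm1.add sp1).div_const 2).tsum_add sfz, tsum_div_const, sm1.tsum_add sp1, e1, e2]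
    rw [h.total] at e3
    linarith

theorem isSymmProb_mu {α : ℝ} (hα : α ∈ Set.Ioo (0 : ℝ) 1) (t : ℕ) : IsSymmProb (mu α t) := by
  induction t with
  | zero =>
    refine ⟨(Set.finite_singleton (0 : ℤ)).subset fun x hx => ?_, fun x => ?_, fun x => ?_, ?_⟩
    · by_contra hn
      exact hx (if_neg hn)
    · simp [mu]
    · simp only [mu]
      split_ifs <;> norm_num
    · simp [mu]
  | succ t ih => exact isSymmProb_step hα ih

/-- `μ_t` as a measure on `ℤ`. -/
def muMeasure (α : ℝ) (t : ℕ) : Measure ℤ :=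
  Measure.sum fun x : ℤ => ENNReal.ofReal (mu α t x) • Measure.dirac x

theorem isProbabilityMeasure_muMeasure {α : ℝ} (hα : α ∈ Set.Ioo (0 : ℝ) 1) (t : ℕ) :
    IsProbabilityMeasure (muMeasure α t) := by
  have h := isSymmProb_mu hα t
  constructor
  simp only [muMeasure, Measure.sum_apply _ MeasurableSet.univ, Measure.smul_apply,
    measure_univ, smul_eq_mul, mul_one]
  rw [← ENNReal.ofReal_tsum_of_nonneg h.nonneg h.summable, h.total, ENNReal.ofReal_one]

/-- The rescaled measure `μ̃_t` on `ℝ`: the image of `μ_t` under `x ↦ x / √t`. -/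
def rescaled (α : ℝ) (hα : α ∈ Set.Ioo (0 : ℝ) 1) (t : ℕ) : ProbabilityMeasure ℝ :=
  ⟨(muMeasure α t).map fun x : ℤ => (x : ℝ) / √(t : ℝ),
    have := isProbabilityMeasure_muMeasure hα t
    Measure.isProbabilityMeasure_map (by fun_prop)⟩

/-- For `t ≥ 1` the rescaled measure is given by `μ̃_t(A) = μ_t({y √t : y ∈ A})`. -/
theorem rescaled_apply {α : ℝ} (hα : α ∈ Set.Ioo (0 : ℝ) 1) {t : ℕ} (ht : 1 ≤ t) {A : Set ℝ}
    (hA : MeasurableSet A) : (rescaled α hα t : Measure ℝ) A =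
      muMeasure α t {x : ℤ | (x : ℝ) ∈ (fun y : ℝ => y * √(t : ℝ)) '' A} := by
  have ht0 : √(t : ℝ) ≠ 0 := (Real.sqrt_pos.2 (by exact_mod_cast ht)).ne'
  change (muMeasure α t).map _ A = _
  rw [Measure.map_apply (by fun_prop) hA]
  congr 1
  ext x
  constructor
  · exact fun hx => ⟨_, hx, div_mul_cancel₀ _ ht0⟩
  · rintro ⟨y, hy, hyx⟩
    simpa only [Set.mem_preimage, ← hyx, mul_div_cancel_right₀ y ht0] using hy

/-- The standard Gaussian measure `Φ` on `ℝ`. -/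
abbrev gauss : Measure ℝ := gaussianReal 0 1

/-- `Φ_q`: the standard Gaussian measure restricted to `[-q, q]` and normalized. -/
def truncGauss (q : ℝ) : Measure ℝ := cond gauss (Set.Icc (-q) q)

/-- The measure `(α / 2) δ(-q) + (1 - α) Φ_q + (α / 2) δ(q)`. -/
def limitMeasure (α q : ℝ) : Measure ℝ :=
  ENNReal.ofReal (α / 2) • Measure.dirac (-q) + ENNReal.ofReal (1 - α) • truncGauss q
    + ENNReal.ofReal (α / 2) • Measure.dirac q

theorem isProbabilityMeasure_limitMeasure {α q : ℝ} (hα : α ∈ Set.Ioo (0 : ℝ) 1) (hq : 0 < q) :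
    IsProbabilityMeasure (limitMeasure α q) := by
  have h0 : gauss (Set.Icc (-q) q) ≠ 0 := by
    intro h
    have h1 := gaussianReal_absolutelyContinuous' 0 (v := 1) one_ne_zero h
    rw [Real.volume_Icc, ENNReal.ofReal_eq_zero] at h1
    linarith
  have h2 : IsProbabilityMeasure (truncGauss q) := cond_isProbabilityMeasure h0
  have := hα.1
  have := hα.2
  constructor
  simp only [limitMeasure, Measure.add_apply, Measure.smul_apply, measure_univ, smul_eq_mul,
    mul_one]
  rw [← ENNReal.ofReal_add (by linarith) (by linarith),
    ← ENNReal.ofReal_add (by linarith) (by linarith), ← ENNReal.ofReal_one]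
  congr 1
  ring

/-- The limiting probability measure. -/
def limit (α q : ℝ) (hα : α ∈ Set.Ioo (0 : ℝ) 1) (hq : 0 < q) : ProbabilityMeasure ℝ :=
  ⟨limitMeasure α q, isProbabilityMeasure_limitMeasure hα hq⟩

/-- The equation for the truncation point. -/
def TruncEq (α q : ℝ) : Prop :=
  α / 2 * q = (1 - α) * Real.exp (-q ^ 2 / 2) / (√(2 * Real.pi) * gauss.real (Set.Icc (-q) q))

end FBD

end

/-!
The proof is the method of moments. The frozen mass at time `t` has total mass `α` and sits at the
sites `y` with `β_t ≤ |y| ≤ β_t + 1`, while the free mass has total mass `1 - α` and lives on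
`[-β_t, β_t]`. The dynamics integrates a test function against the free mass through its discrete
Laplacian (`tsum_step_mul`). For `x ^ (2 n + 2)` the Laplacian is `(n + 1) (2 n + 1) x ^ (2 n)` up
to lower order, so if `β_t / √t → l`, then Stolz–Cesàro gives by induction on `n` that the moments
of order `2 n` of the rescaled free mass converge to numbers `c n` with
`c 0 = 1 - α`, `c (n + 1) = (2 n + 1) c n - α l ^ (2 n + 2)` and `0 ≤ c n ≤ (1 - α) l ^ (2 n)`
(`exists_isMomentSeq`).

A solution `q` of the truncation equation produces, by integration by parts, the same recursion
with `q` in place of `l` for the moments of `(1 - α) Φ_q` (`isMomentSeq_gauss`). The recursion and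
the bound together determine the end point, because for two different end points the difference of
the sequences would grow factorially (`IsMomentSeq.endpoint_eq`). This gives both the uniqueness of
`q` and `l = q`. Hence all even moments of the rescaled measures converge to those of the limit; the
odd ones vanish by symmetry, and as everything lives on a fixed compact interval, Weierstrass
approximation turns this into weak convergence (`tendsto_of_moments`). Existence of `q` is the
intermediate value theorem.
-/

noncomputable section

namespace FBD

/-! ### Second differences and averaging -/

/-- Second-order Taylor expansion of a power, with a remainder that is uniform for `y` in a bounded
set. -/
theorem exists_abs_add_pow_sub_le (n : ℕ) {R : ℝ} (hR : 0 ≤ R) :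
    ∃ K, 0 ≤ K ∧ ∀ y h : ℝ, |y| ≤ R → |h| ≤ 1 →
      |(y + h) ^ (n + 2) - y ^ (n + 2) - (n + 2) * y ^ (n + 1) * h
        - (n + 2) * (n + 1) / 2 * y ^ n * h ^ 2| ≤ K * |h| ^ 3 := by
  induction n with
  | zero =>
    refine ⟨0, le_rfl, fun y h _ _ => ?_⟩
    have : (y + h) ^ (0 + 2) - y ^ (0 + 2) - ((0 : ℕ) + 2) * y ^ (0 + 1) * h
        - ((0 : ℕ) + 2) * ((0 : ℕ) + 1) / 2 * y ^ 0 * h ^ 2 = 0 := by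
      push_cast
      ring
    rw [this]
    simp
  | succ n ih =>
    obtain ⟨K, hK, H⟩ := ih
    refine ⟨(R + 1) * K + (n + 2) * (n + 1) / 2 * R ^ n, by positivity, fun y h hy hh => ?_⟩
    have e : (y + h) ^ (n + 1 + 2) - y ^ (n + 1 + 2) - ((n + 1 : ℕ) + 2) * y ^ (n + 1 + 1) * h
        - ((n + 1 : ℕ) + 2) * ((n + 1 : ℕ) + 1) / 2 * y ^ (n + 1) * h ^ 2
        = (y + h) * ((y + h) ^ (n + 2) - y ^ (n + 2) - (n + 2) * y ^ (n + 1) * h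
          - (n + 2) * (n + 1) / 2 * y ^ n * h ^ 2) + (n + 2) * (n + 1) / 2 * y ^ n * h ^ 3 := by
      push_cast
      ring
    rw [e, add_mul _ _ (|h| ^ 3)]
    refine (abs_add_le _ _).trans (add_le_add ?_ ?_)
    · rw [abs_mul, mul_assoc (R + 1)]
      exact mul_le_mul ((abs_add_le _ _).trans (add_le_add hy hh)) (H y h hy hh)
        (abs_nonneg _) (by positivity)
    · rw [abs_mul, abs_mul, abs_pow, abs_pow, abs_of_nonneg (by positivity : (0 : ℝ) ≤ _ / 2)]
      gcongr

/-- On `[-R s, R s]` the second difference of `x ↦ x ^ (n + 2)` with step `1` agrees with half the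
second derivative up to a relative error of order `1 / s`. -/
theorem exists_abs_second_diff_sub_le (n : ℕ) {R : ℝ} (hR : 0 ≤ R) :
    ∃ K, ∀ s x : ℝ, 1 ≤ s → |x| ≤ R * s →
      |((x + 1) ^ (n + 2) + (x - 1) ^ (n + 2)) / 2 - x ^ (n + 2)
        - (n + 2) * (n + 1) / 2 * x ^ n| ≤ K * s ^ n / s := by
  obtain ⟨K, -, H⟩ := exists_abs_add_pow_sub_le n hR
  refine ⟨K, fun s x hs hx => ?_⟩
  have hs0 : 0 < s := by linarith
  -- rescale to `y = x / s` and step `h = 1 / s`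
  obtain ⟨y, rfl⟩ : ∃ y, x = s * y := ⟨x / s, by field_simp⟩
  obtain ⟨h, hh⟩ : ∃ h, s * h = 1 := ⟨1 / s, by field_simp⟩
  have hh' : h = 1 / s := by field_simp; linarith
  have hhpos : 0 < h := by rw [hh']; positivity
  have hh1 : |h| ≤ 1 := by
    rw [abs_of_pos hhpos, hh', div_le_one hs0]
    exact hs
  have hy : |y| ≤ R := by
    rw [abs_mul, abs_of_pos hs0, mul_comm] at hx
    exact le_of_mul_le_mul_right hx hs0
  have h1 := H y h hy hh1
  have h2 := H y (-h) hy (by rwa [abs_neg])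
  rw [abs_neg, abs_of_pos hhpos] at h2
  rw [abs_of_pos hhpos] at h1
  have e : ((s * y + 1) ^ (n + 2) + (s * y - 1) ^ (n + 2)) / 2 - (s * y) ^ (n + 2)
      - (n + 2) * (n + 1) / 2 * (s * y) ^ n = s ^ (n + 2) * (((y + h) ^ (n + 2)
        - y ^ (n + 2) - (n + 2) * y ^ (n + 1) * h - (n + 2) * (n + 1) / 2 * y ^ n * h ^ 2
        + ((y + -h) ^ (n + 2) - y ^ (n + 2) - (n + 2) * y ^ (n + 1) * -h
        - (n + 2) * (n + 1) / 2 * y ^ n * (-h) ^ 2)) / 2) := by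
    have e1 : (s * y + 1) ^ (n + 2) = s ^ (n + 2) * (y + h) ^ (n + 2) := by
      rw [← mul_pow, mul_add, hh]
    have e2 : (s * y - 1) ^ (n + 2) = s ^ (n + 2) * (y + -h) ^ (n + 2) := by
      rw [← mul_pow, mul_add, mul_neg, hh, sub_eq_add_neg]
    have e3 : (s * y) ^ n = s ^ (n + 2) * (y ^ n * h ^ 2) := by
      rw [mul_pow, pow_add, ← one_mul (s ^ n * y ^ n), ← one_pow 2, ← hh]
      ring
    rw [e1, e2, e3, mul_pow]
    ring
  rw [e, abs_mul, abs_of_pos (by positivity)]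
  have h3 : K * s ^ n / s = s ^ (n + 2) * (K * h ^ 3) := by
    rw [hh', pow_add]
    field_simp
  rw [h3]
  gcongr
  rw [abs_le] at *
  constructor <;> linarith

theorem tendsto_succ_pow_sub_pow_div (n : ℕ) :
    Tendsto (fun t : ℕ => (((t : ℝ) + 1) ^ (n + 1) - (t : ℝ) ^ (n + 1)) / (t : ℝ) ^ n) atTop
      (𝓝 (n + 1)) := by
  induction n with
  | zero => simp
  | succ n ih =>
    have h1 : Tendsto (fun t : ℕ => 1 + 1 / (t : ℝ)) atTop (𝓝 (1 + 0)) :=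
      tendsto_const_nhds.add tendsto_one_div_atTop_nhds_zero_nat
    have h2 := (h1.mul ih).add_const 1
    have e : (1 + 0) * ((n : ℝ) + 1) + 1 = (n + 1 : ℕ) + 1 := by
      push_cast
      ring
    rw [e] at h2
    refine h2.congr' ?_
    filter_upwards [eventually_gt_atTop 0] with t ht
    have : (t : ℝ) ≠ 0 := by positivity
    field_simp
    ring

/-- The Stolz–Cesàro theorem for comparison with powers of `t`. -/
theorem tendsto_div_pow_of_tendsto_diff {a : ℕ → ℝ} {n : ℕ} {D : ℝ}
    (h : Tendsto (fun t : ℕ => (a (t + 1) - a t) / (t : ℝ) ^ n) atTop (𝓝 D)) :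
    Tendsto (fun t : ℕ => a t / (t : ℝ) ^ (n + 1)) atTop (𝓝 (D / (n + 1))) := by
  set g : ℕ → ℝ := fun t => ((t : ℝ) + 1) ^ (n + 1) - (t : ℝ) ^ (n + 1) with hg
  have hgle : ∀ t : ℕ, (t : ℝ) ^ n ≤ g t := fun t => by
    have h1 : (t : ℝ) ^ n ≤ ((t : ℝ) + 1) ^ n := by gcongr; linarith
    have h2 : (0 : ℝ) ≤ t := by positivity
    simp only [hg, pow_succ]
    nlinarith
  have hsum : ∀ t, ∑ i ∈ Finset.range t, g i = (t : ℝ) ^ (n + 1) := fun t => by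
    have := Finset.sum_range_sub (fun i : ℕ => (i : ℝ) ^ (n + 1)) t
    simpa [hg] using this
  have hn : (n : ℝ) + 1 ≠ 0 := by positivity
  have hf : (fun t => a (t + 1) - a t - D / (n + 1) * g t) =o[atTop] g := by
    have h1 : (fun t => a (t + 1) - a t - D / (n + 1) * g t) =o[atTop]
        fun t : ℕ => (t : ℝ) ^ n := by
      rw [Asymptotics.isLittleO_iff_tendsto']
      · have h2 := h.sub ((tendsto_succ_pow_sub_pow_div n).const_mul (D / (n + 1)))
        rw [div_mul_cancel₀ _ hn, sub_self] at h2
        refine h2.congr fun t => ?_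
        simp only [hg]
        ring
      · filter_upwards [eventually_gt_atTop 0] with t ht h0
        exact absurd h0 (by positivity)
    refine h1.trans_isBigO (Asymptotics.IsBigO.of_bound 1 (Eventually.of_forall fun t => ?_))
    rw [one_mul, Real.norm_of_nonneg (by positivity), Real.norm_eq_abs]
    exact (hgle t).trans (le_abs_self _)
  have htop : Tendsto (fun t : ℕ => (t : ℝ) ^ (n + 1)) atTop atTop :=
    (tendsto_pow_atTop (by omega)).comp tendsto_natCast_atTop_atTop
  have h3 := hf.sum_range (fun t => le_trans (by positivity) (hgle t)) (by simpa only [hsum])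
  have hsum' : ∀ t, ∑ i ∈ Finset.range t, (a (i + 1) - a i - D / (n + 1) * g i) =
      a t - a 0 - D / (n + 1) * (t : ℝ) ^ (n + 1) := fun t => by
    rw [Finset.sum_sub_distrib, ← Finset.mul_sum, hsum, Finset.sum_range_sub]
  simp only [hsum, hsum'] at h3
  have h4 := ((h3.tendsto_div_nhds_zero.add (htop.const_div_atTop (a 0))).add_const (D / (n + 1)))
  rw [zero_add, zero_add] at h4
  refine h4.congr' ?_
  filter_upwards [eventually_gt_atTop 0] with t ht
  have : (t : ℝ) ^ (n + 1) ≠ 0 := by positivity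
  field_simp
  ring

/-! ### The moment recursion -/

/-- The recursion satisfied by the even moments `c n` of a measure on `[-q, q]` of mass `1 - α`
that is the free part of a limit with frozen mass `α / 2` at `q` and at `-q`. -/
structure IsMomentSeq (α q : ℝ) (c : ℕ → ℝ) : Prop where
  zero : c 0 = 1 - α
  succ : ∀ n, c (n + 1) = (2 * n + 1) * c n - α * q ^ (2 * n + 2)
  nonneg : ∀ n, 0 ≤ c n
  le : ∀ n, c n ≤ (1 - α) * q ^ (2 * n)

/-- If `l < q`, the difference of the two sequences grows like a factorial, while both are
exponentially bounded. -/
theorem IsMomentSeq.not_lt {α l q : ℝ} (hα : 0 < α) {c d : ℕ → ℝ} (hl : 0 ≤ l)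
    (hc : IsMomentSeq α l c) (hd : IsMomentSeq α q d) : ¬ l < q := by
  intro hlt
  set e := fun n => c n - d n
  have he1 : 0 < e 1 := by
    have h1 := hc.succ 0
    have h2 := hd.succ 0
    rw [hc.zero] at h1
    rw [hd.zero] at h2
    have h3 : l ^ 2 < q ^ 2 := by gcongr
    simp only [e, zero_add] at *
    rw [h1, h2]
    norm_num
    exact mul_lt_mul_of_pos_left h3 hα
  have hgrow : ∀ n : ℕ, (n.factorial : ℝ) * e 1 ≤ e (n + 1) := by
    intro n
    induction n with
    | zero => simp
    | succ n ih =>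
      have h1 : l ^ (2 * (n + 1) + 2) ≤ q ^ (2 * (n + 1) + 2) := by gcongr
      have h2 := mul_le_mul_of_nonneg_left h1 hα.le
      have h3 : e (n + 1 + 1) = (2 * (n + 1 : ℕ) + 1) * e (n + 1)
          + (α * q ^ (2 * (n + 1) + 2) - α * l ^ (2 * (n + 1) + 2)) := by
        simp only [e]
        rw [hc.succ, hd.succ]
        ring
      rw [Nat.factorial_succ, h3]
      push_cast
      have h4 : 0 ≤ (n.factorial : ℝ) * e 1 := by positivity
      nlinarith
  have hlim := FloorSemiring.tendsto_pow_div_factorial_atTop (l ^ 2)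
  have hlim' := hlim.const_mul ((1 - α) * l ^ 2)
  rw [mul_zero] at hlim'
  obtain ⟨n, hn⟩ := (hlim'.eventually (gt_mem_nhds he1)).exists
  have h5 := hc.le (n + 1)
  have h6 := hd.nonneg (n + 1)
  have h7 := hgrow n
  have h8 : (0 : ℝ) < n.factorial := by positivity
  rw [← mul_div_assoc, div_lt_iff₀ h8] at hn
  have h9 : (1 - α) * l ^ (2 * (n + 1)) = (1 - α) * l ^ 2 * (l ^ 2) ^ n := by ring
  simp only [e] at *
  linarith

theorem IsMomentSeq.endpoint_eq {α l q : ℝ} (hα : 0 < α) {c d : ℕ → ℝ} (hl : 0 ≤ l) (hq : 0 ≤ q)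
    (hc : IsMomentSeq α l c) (hd : IsMomentSeq α q d) : l = q :=
  le_antisymm (le_of_not_gt (hd.not_lt hα hq hc)) (le_of_not_gt (hc.not_lt hα hl hd))

theorem IsMomentSeq.eq {α q : ℝ} {c d : ℕ → ℝ} (hc : IsMomentSeq α q c)
    (hd : IsMomentSeq α q d) (n : ℕ) : c n = d n := by
  induction n with
  | zero => rw [hc.zero, hd.zero]
  | succ n ih => rw [hc.succ, hd.succ, ih]

/-! ### Moments of the truncated Gaussian -/

/-- The unnormalized even moments of the Gaussian on `[-q, q]`. -/
def gaussMoment (q : ℝ) (n : ℕ) : ℝ := ∫ x in -q..q, x ^ (2 * n) * Real.exp (-x ^ 2 / 2)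

theorem gaussMoment_succ (q : ℝ) (n : ℕ) : gaussMoment q (n + 1) =
    (2 * n + 1) * gaussMoment q n - 2 * q ^ (2 * n + 1) * Real.exp (-q ^ 2 / 2) := by
  have hd : ∀ x : ℝ, HasDerivAt (fun x : ℝ => x ^ (2 * n + 1) * Real.exp (-x ^ 2 / 2))
      ((2 * n + 1) * (x ^ (2 * n) * Real.exp (-x ^ 2 / 2))
        - x ^ (2 * (n + 1)) * Real.exp (-x ^ 2 / 2)) x := by
    intro x
    have h1 : HasDerivAt (fun x : ℝ => -x ^ 2 / 2) (-x) x := by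
      refine ((hasDerivAt_pow 2 x).neg.div_const 2).congr_deriv ?_
      push_cast
      ring
    refine ((hasDerivAt_pow (2 * n + 1) x).mul h1.exp).congr_deriv ?_
    push_cast
    ring
  have h := intervalIntegral.integral_eq_sub_of_hasDerivAt (a := -q) (b := q)
    (fun x _ => hd x) (Continuous.intervalIntegrable (by fun_prop) _ _)
  rw [intervalIntegral.integral_sub (Continuous.intervalIntegrable (by fun_prop) _ _)
    (Continuous.intervalIntegrable (by fun_prop) _ _), intervalIntegral.integral_const_mul] at h
  have e : (-q) ^ (2 * n + 1) = -q ^ (2 * n + 1) := Odd.neg_pow ⟨n, rfl⟩ q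
  rw [e, neg_sq] at h
  unfold gaussMoment
  linarith

theorem gaussMoment_zero_pos {q : ℝ} (hq : 0 < q) : 0 < gaussMoment q 0 :=
  intervalIntegral.intervalIntegral_pos_of_pos_on (Continuous.intervalIntegrable (by fun_prop) _ _)
    (fun x _ => mul_pos (by simp) (Real.exp_pos _)) (by linarith)

theorem gaussMoment_nonneg {q : ℝ} (hq : 0 < q) (n : ℕ) : 0 ≤ gaussMoment q n :=
  intervalIntegral.integral_nonneg (by linarith) fun x _ =>
    mul_nonneg ((even_two_mul n).pow_nonneg x) (Real.exp_pos _).le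

theorem gaussMoment_le {q : ℝ} (hq : 0 < q) (n : ℕ) :
    gaussMoment q n ≤ q ^ (2 * n) * gaussMoment q 0 := by
  unfold gaussMoment
  rw [← intervalIntegral.integral_const_mul]
  refine intervalIntegral.integral_mono_on (by linarith)
    (Continuous.intervalIntegrable (by fun_prop) _ _)
    (Continuous.intervalIntegrable (by fun_prop) _ _) fun x hx => ?_
  rw [mul_zero, pow_zero, one_mul]
  have : x ^ (2 * n) ≤ q ^ (2 * n) := by
    rw [← (even_two_mul n).pow_abs]
    exact pow_le_pow_left₀ (abs_nonneg x) (abs_le.2 hx) _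
  gcongr

theorem setIntegral_gauss {q : ℝ} (hq : 0 < q) (f : ℝ → ℝ) :
    ∫ x in Set.Icc (-q) q, f x ∂gauss =
      (√(2 * Real.pi))⁻¹ * ∫ x in -q..q, f x * Real.exp (-x ^ 2 / 2) := by
  rw [gauss, gaussianReal_of_var_ne_zero 0 one_ne_zero,
    setIntegral_withDensity_eq_setIntegral_toReal_smul (by fun_prop)
      (by simp [gaussianPDF]) _ measurableSet_Icc,
    intervalIntegral.integral_of_le (by linarith), ← integral_Icc_eq_integral_Ioc,
    ← integral_const_mul]
  refine integral_congr_ae (Eventually.of_forall fun x => ?_)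
  simp only [toReal_gaussianPDF, gaussianPDFReal_def, smul_eq_mul]
  simp
  ring

theorem gauss_real_Icc {q : ℝ} (hq : 0 < q) :
    gauss.real (Set.Icc (-q) q) = (√(2 * Real.pi))⁻¹ * gaussMoment q 0 := by
  have h := setIntegral_gauss hq fun _ => 1
  simp only [setIntegral_const, smul_eq_mul, mul_one] at h
  rw [h]
  simp [gaussMoment]

theorem integral_truncGauss {q : ℝ} (hq : 0 < q) (f : ℝ → ℝ) :
    ∫ x, f x ∂truncGauss q =
      (∫ x in -q..q, f x * Real.exp (-x ^ 2 / 2)) / gaussMoment q 0 := by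
  have h0 : √(2 * Real.pi) ≠ 0 := by positivity
  have h1 := (gaussMoment_zero_pos hq).ne'
  rw [truncGauss, ProbabilityTheory.cond, integral_smul_measure, setIntegral_gauss hq,
    ENNReal.toReal_inv, ← Measure.real, gauss_real_Icc hq, smul_eq_mul]
  field_simp

theorem truncEq_iff {α q : ℝ} (hq : 0 < q) :
    TruncEq α q ↔ α / 2 * q * gaussMoment q 0 = (1 - α) * Real.exp (-q ^ 2 / 2) := by
  have h0 : √(2 * Real.pi) ≠ 0 := by positivity
  rw [TruncEq, gauss_real_Icc hq, mul_inv_cancel_left₀ h0,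
    eq_div_iff (gaussMoment_zero_pos hq).ne']

theorem isMomentSeq_gauss {α q : ℝ} (hα : α < 1) (hq : 0 < q) (h : TruncEq α q) :
    IsMomentSeq α q fun n => (1 - α) * (gaussMoment q n / gaussMoment q 0) := by
  have h0 := gaussMoment_zero_pos hq
  have h1 : 0 ≤ 1 - α := by linarith
  rw [truncEq_iff hq] at h
  refine ⟨by simp [h0.ne'], fun n => ?_, fun n => ?_, fun n => ?_⟩
  · rw [gaussMoment_succ]
    generalize Real.exp (-q ^ 2 / 2) = E at h ⊢
    field_simp
    linear_combination 2 * q ^ (2 * n + 1) * h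
  · exact mul_nonneg h1 (div_nonneg (gaussMoment_nonneg hq n) h0.le)
  · exact mul_le_mul_of_nonneg_left ((div_le_iff₀ h0).2 (gaussMoment_le hq n)) h1

/-- The two sides of the truncation equation cross: the left side vanishes at `0`, and beyond `1` it
grows at least linearly, whereas the right side stays below `1`. -/
theorem exists_truncEq {α : ℝ} (hα : α ∈ Set.Ioo (0 : ℝ) 1) : ∃ q, 0 < q ∧ TruncEq α q := by
  obtain ⟨h0, h1⟩ := hα
  set F : ℝ → ℝ := fun q => α / 2 * q * gaussMoment q 0 - (1 - α) * Real.exp (-q ^ 2 / 2)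
  have hcont : Continuous F := by
    have hg : Continuous fun q => gaussMoment q 0 := by
      have hc : Continuous fun x : ℝ => x ^ (2 * 0) * Real.exp (-x ^ 2 / 2) := by fun_prop
      have hi : ∀ a b : ℝ, IntervalIntegrable (fun x : ℝ => x ^ (2 * 0) * Real.exp (-x ^ 2 / 2))
        volume a b := fun a b => hc.intervalIntegrable a b
      have hp := intervalIntegral.continuous_primitive hi 0
      have : (fun q => gaussMoment q 0) = fun q =>
          (∫ x in (0 : ℝ)..q, x ^ (2 * 0) * Real.exp (-x ^ 2 / 2))
            - ∫ x in (0 : ℝ)..(-q), x ^ (2 * 0) * Real.exp (-x ^ 2 / 2) := by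
        funext q
        rw [intervalIntegral.integral_interval_sub_left (hi _ _) (hi _ _)]
        rfl
      rw [this]
      exact hp.sub (hp.comp continuous_neg)
    fun_prop
  have hA := gaussMoment_zero_pos one_pos
  set A := gaussMoment 1 0
  -- chosen such that `α / 2 * Q * A` exceeds `1`
  set Q : ℝ := 1 + 2 / (α * A) with hQ
  have hQ1 : 1 ≤ Q := le_add_of_nonneg_right (by positivity)
  have hmono : A ≤ gaussMoment Q 0 := by
    refine intervalIntegral.integral_mono_interval (by linarith) (by norm_num) hQ1
      (Eventually.of_forall fun x => ?_) (Continuous.intervalIntegrable (by fun_prop) _ _)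
    exact mul_nonneg (by simp) (Real.exp_pos _).le
  have hF0 : F 0 < 0 := by
    simp only [F]
    norm_num
    exact h1
  have hFQ : 0 < F Q := by
    have e1 : Real.exp (-Q ^ 2 / 2) ≤ 1 := Real.exp_le_one_iff.2 (by nlinarith [sq_nonneg Q])
    have e2 : α / 2 * Q * A ≤ α / 2 * Q * gaussMoment Q 0 := by gcongr
    have e3 : α / 2 * Q * A = α / 2 * A + 1 := by
      rw [hQ]
      field_simp
    have e4 : (1 - α) * Real.exp (-Q ^ 2 / 2) ≤ 1 - α :=
      mul_le_of_le_one_right (by linarith) e1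
    have e5 : 0 < α / 2 * A := by positivity
    simp only [F]
    linarith
  obtain ⟨q, hq, hFq⟩ := intermediate_value_Ioo (by linarith : (0 : ℝ) ≤ Q) hcont.continuousOn
    ⟨hF0, hFQ⟩
  exact ⟨q, hq.1, (truncEq_iff hq.1).2 (sub_eq_zero.1 hFq)⟩

/-! ### Weak convergence from moments -/

/-- Method of moments on a fixed compact interval, by Weierstrass approximation. -/
theorem tendsto_of_moments {P : ℕ → ProbabilityMeasure ℝ} {Q : ProbabilityMeasure ℝ} {R : ℝ}
    (hP : ∀ᶠ t in atTop, ∀ᵐ x ∂(P t : Measure ℝ), x ∈ Set.Icc (-R) R)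
    (hQ : ∀ᵐ x ∂(Q : Measure ℝ), x ∈ Set.Icc (-R) R)
    (hm : ∀ k : ℕ, Tendsto (fun t => ∫ x, x ^ k ∂(P t : Measure ℝ)) atTop
      (𝓝 (∫ x, x ^ k ∂(Q : Measure ℝ)))) :
    Tendsto P atTop (𝓝 Q) := by
  have hint : ∀ (μ : ProbabilityMeasure ℝ), (∀ᵐ x ∂(μ : Measure ℝ), x ∈ Set.Icc (-R) R) →
      ∀ f : ℝ → ℝ, Continuous f → Integrable f (μ : Measure ℝ) := by
    intro μ hμ f hf
    obtain ⟨C, hC⟩ := isCompact_Icc.exists_bound_of_continuousOn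
      (hf.continuousOn (s := Set.Icc (-R) R))
    exact Integrable.of_bound hf.aestronglyMeasurable C (hμ.mono hC)
  have hpoly : ∀ (μ : ProbabilityMeasure ℝ), (∀ᵐ x ∂(μ : Measure ℝ), x ∈ Set.Icc (-R) R) →
      ∀ p : Polynomial ℝ, ∫ x, p.eval x ∂(μ : Measure ℝ) =
        ∑ i ∈ Finset.range (p.natDegree + 1), p.coeff i * ∫ x, x ^ i ∂(μ : Measure ℝ) := by
    intro μ hμ p
    simp only [Polynomial.eval_eq_sum_range]
    rw [integral_finsetSum _ fun i _ => hint μ hμ _ (by fun_prop)]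
    simp only [integral_const_mul]
  rw [ProbabilityMeasure.tendsto_iff_forall_integral_tendsto]
  intro f
  rw [Metric.tendsto_atTop']
  intro ε hε
  obtain ⟨p, hp⟩ := exists_polynomial_near_of_continuousOn (-R) R f f.continuous.continuousOn
    (ε / 4) (by positivity)
  have hclose : ∀ (μ : ProbabilityMeasure ℝ), (∀ᵐ x ∂(μ : Measure ℝ), x ∈ Set.Icc (-R) R) →
      |∫ x, p.eval x ∂(μ : Measure ℝ) - ∫ x, f x ∂(μ : Measure ℝ)| ≤ ε / 4 := by
    intro μ hμ
    rw [← integral_sub (hint μ hμ _ p.continuous) (hint μ hμ _ f.continuous)]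
    have := norm_integral_le_of_norm_le_const (μ := (μ : Measure ℝ)) (C := ε / 4)
      (f := fun x => p.eval x - f x) (hμ.mono fun x hx => (hp x hx).le)
    simpa using this
  have hlim : Tendsto (fun t => ∫ x, p.eval x ∂(P t : Measure ℝ)) atTop
      (𝓝 (∫ x, p.eval x ∂(Q : Measure ℝ))) := by
    rw [hpoly Q hQ]
    refine Tendsto.congr' (hP.mono fun t ht => (hpoly (P t) ht p).symm) ?_
    exact tendsto_finsetSum _ fun i _ => (hm i).const_mul _
  obtain ⟨N, hN⟩ := eventually_atTop.1
    (hP.and (hlim.eventually (Metric.ball_mem_nhds _ (by positivity : 0 < ε / 4))))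
  refine ⟨N, fun t ht => ?_⟩
  obtain ⟨h1, h2⟩ := hN t ht.le
  have h3 := hclose _ h1
  have h4 := hclose _ hQ
  simp only [Real.dist_eq] at h2
  rw [Real.dist_eq]
  rw [abs_le] at h3 h4
  rw [abs_lt] at h2 ⊢
  constructor <;> linarith

/-! ### Location of the free and the frozen mass -/

variable {α : ℝ} {m : ℤ → ℝ}

theorem summable_mul_of_finite_support (hm : (Function.support m).Finite) (g : ℤ → ℝ) :
    Summable fun x => m x * g x :=
  summable_of_hasFiniteSupport (hm.subset (Function.support_mul_subset_left m g))

theorem finite_support_frozen (hα : α ∈ Set.Ioo (0 : ℝ) 1) (h : IsSymmProb m) :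
    (Function.support (frozen α m)).Finite :=
  h.finite.subset fun y hy hm =>
    hy (le_antisymm ((frozen_le hα h y).trans_eq hm) (frozen_nonneg hα h y))

theorem finite_support_free (hα : α ∈ Set.Ioo (0 : ℝ) 1) (h : IsSymmProb m) :
    (Function.support (free α m)).Finite :=
  (h.finite.union (finite_support_frozen hα h)).subset (Function.support_sub m (frozen α m))

theorem free_nonneg (hα : α ∈ Set.Ioo (0 : ℝ) 1) (h : IsSymmProb m) (y : ℤ) : 0 ≤ free α m y :=
  sub_nonneg.2 (frozen_le hα h y)

theorem hasSum_rightFrozen (α : ℝ) (h : IsSymmProb m) : HasSum (rightFrozen α m) (α / 2) := by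
  have h1 : HasSum ((Set.Ioi (boundary α m)).indicator m) (massOf m (Set.Ioi (boundary α m))) := by
    rw [massOf, tsum_subtype]
    exact (h.summable.indicator _).hasSum
  have h2 := h1.add (hasSum_ite_eq (boundary α m) (α / 2 - massOf m (Set.Ioi (boundary α m))))
  rw [add_sub_cancel] at h2
  refine h2.congr_fun fun y => ?_
  unfold rightFrozen
  by_cases hy : boundary α m < y
  · simp [hy, hy.ne']
  · simp [hy]

theorem hasSum_frozen (α : ℝ) (h : IsSymmProb m) : HasSum (frozen α m) α := by
  have h1 := hasSum_rightFrozen α h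
  have h2 := h1.add ((Equiv.neg ℤ).hasSum_iff.2 h1)
  rw [add_halves] at h2
  exact h2

theorem hasSum_free (α : ℝ) (h : IsSymmProb m) : HasSum (free α m) (1 - α) := by
  have h1 := h.summable.hasSum
  rw [h.total] at h1
  exact h1.sub (hasSum_frozen α h)

theorem abs_le_boundary_of_free_ne_zero (hα : α ∈ Set.Ioo (0 : ℝ) 1) (h : IsSymmProb m) {y : ℤ}
    (hy : free α m y ≠ 0) : |y| ≤ boundary α m := by
  have hb := boundary_nonneg hα h
  have key : ∀ z, boundary α m < z → free α m z = 0 := by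
    intro z hz
    rw [free, frozen, rightFrozen_of_neg hα h (y := -z) (by omega), rightFrozen, if_pos hz]
    ring
  rw [abs_le]
  constructor
  · by_contra hlt
    have h1 := key (-y) (by omega)
    rw [free, frozen_neg, h.symm] at h1
    exact hy h1
  · by_contra hlt
    exact hy (key y (by omega))

theorem boundary_le_abs_of_frozen_ne_zero {y : ℤ} (hy : frozen α m y ≠ 0) :
    boundary α m ≤ |y| := by
  have key : ∀ z, rightFrozen α m z ≠ 0 → boundary α m ≤ z := by
    intro z hz
    by_contra hlt
    apply hz
    rw [rightFrozen, if_neg (by omega), if_neg (by omega)]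
  by_cases h1 : rightFrozen α m y = 0
  · have h2 : rightFrozen α m (-y) ≠ 0 := fun h2 => hy (by rw [frozen, h1, h2, add_zero])
    exact (key _ h2).trans (neg_le_abs y)
  · exact (key _ h1).trans (le_abs_self y)

/-- The right frozen mass `α / 2` stays at or beyond the boundary, so the boundary cannot
retreat. -/
theorem boundary_le_boundary_step (hα : α ∈ Set.Ioo (0 : ℝ) 1) (h : IsSymmProb m) :
    boundary α m ≤ boundary α (step α m) := by
  have hs := isSymmProb_step hα h
  refine le_csSup (hs.bddAbove hα.1) ?_
  simp only [Set.mem_ofPred_eq]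
  rw [← (hasSum_rightFrozen α h).tsum_eq, massOf, tsum_subtype]
  refine (hasSum_rightFrozen α h).summable.tsum_le_tsum (fun y => ?_) (hs.summable.indicator _)
  by_cases hy : boundary α m ≤ y
  · rw [Set.indicator_of_mem (Set.mem_Ici.2 hy)]
    have h1 := free_nonneg hα h (y - 1)
    have h2 := free_nonneg hα h (y + 1)
    have h3 := rightFrozen_nonneg hα h (-y)
    unfold step frozen
    linarith
  · rw [Set.indicator_of_notMem (by simpa using hy), rightFrozen, if_neg (by omega),
      if_neg (by omega)]

/-- The mass never gets more than one site beyond the boundary. -/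
theorem abs_le_beta_add_one (hα : α ∈ Set.Ioo (0 : ℝ) 1) (t : ℕ) {x : ℤ} (hx : mu α t x ≠ 0) :
    |x| ≤ beta α t + 1 := by
  induction t generalizing x with
  | zero =>
    have h0 : x = 0 := by
      by_contra hn
      exact hx (if_neg hn)
    have := boundary_nonneg hα (isSymmProb_mu hα 0)
    rw [h0, abs_zero, beta]
    omega
  | succ t ih =>
    have h := isSymmProb_mu hα t
    have hle : beta α t ≤ beta α (t + 1) := boundary_le_boundary_step hα h
    suffices |x| ≤ beta α t + 1 by omega
    by_contra hlt
    have h0 : frozen α (mu α t) x = 0 := by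
      by_contra hn
      refine hlt (ih fun hm => hn ?_)
      exact le_antisymm ((frozen_le hα h x).trans_eq hm) (frozen_nonneg hα h x)
    have h1 : ∀ y : ℤ, |x - y| ≤ 1 → free α (mu α t) y = 0 := by
      intro y hy
      by_contra hn
      have h2 : |y| ≤ beta α t := abs_le_boundary_of_free_ne_zero hα h hn
      rw [abs_le] at *
      omega
    apply hx
    rw [mu, step, h0, h1 (x - 1) (by simp), h1 (x + 1) (by simp)]
    norm_num

/-! ### Evolution of the moments -/

/-- Frozen-boundary diffusion changes the integral of a test function `g` by the integral of its
discrete Laplacian against the free mass. -/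
theorem tsum_step_mul (hα : α ∈ Set.Ioo (0 : ℝ) 1) (h : IsSymmProb m) (g : ℤ → ℝ) :
    ∑' x, step α m x * g x =
      ∑' x, m x * g x + ∑' x, free α m x * ((g (x + 1) + g (x - 1)) / 2 - g x) := by
  have hfr := finite_support_free hα h
  have hfz := finite_support_frozen hα h
  have S := fun g => summable_mul_of_finite_support hfr g
  have Z := fun g => summable_mul_of_finite_support hfz g
  have s1 : Summable fun x => free α m (x - 1) * g x := by
    have := (Equiv.subRight (1 : ℤ)).summable_iff.2 (S fun x => g (x + 1))
    simpa [Function.comp_def] using this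
  have s2 : Summable fun x => free α m (x + 1) * g x := by
    have := (Equiv.addRight (1 : ℤ)).summable_iff.2 (S fun x => g (x - 1))
    simpa [Function.comp_def] using this
  have e1 : ∑' x, free α m (x - 1) * g x = ∑' x, free α m x * g (x + 1) := by
    rw [← (Equiv.subRight (1 : ℤ)).tsum_eq (fun x => free α m x * g (x + 1))]
    simp
  have e2 : ∑' x, free α m (x + 1) * g x = ∑' x, free α m x * g (x - 1) := by
    rw [← (Equiv.addRight (1 : ℤ)).tsum_eq (fun x => free α m x * g (x - 1))]
    simp
  have e3 : ∑' x, step α m x * g x = (∑' x, free α m x * g (x + 1)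
      + ∑' x, free α m x * g (x - 1)) / 2 + ∑' x, frozen α m x * g x := by
    rw [← e1, ← e2, ← s1.tsum_add s2, ← tsum_div_const, ← ((s1.add s2).div_const 2).tsum_add (Z g)]
    exact tsum_congr fun x => by unfold step; ring
  have e4 : ∑' x, m x * g x = ∑' x, free α m x * g x + ∑' x, frozen α m x * g x := by
    rw [← (S g).tsum_add (Z g)]
    exact tsum_congr fun x => by unfold free; ring
  have e5 : ∑' x, free α m x * ((g (x + 1) + g (x - 1)) / 2 - g x) =
      (∑' x, free α m x * g (x + 1) + ∑' x, free α m x * g (x - 1)) / 2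
        - ∑' x, free α m x * g x := by
    rw [← (S fun x => g (x + 1)).tsum_add (S fun x => g (x - 1)), ← tsum_div_const,
      ← (((S fun x => g (x + 1)).add (S fun x => g (x - 1))).div_const 2).tsum_sub (S g)]
    exact tsum_congr fun x => by ring
  rw [e3, e4, e5]
  ring

/-- The moment of order `2 n` of a mass distribution on `ℤ`; the junk value of the sum is
irrelevant, as only finitely supported `m` occur. -/
def evenMoment (m : ℤ → ℝ) (n : ℕ) : ℝ := ∑' x : ℤ, m x * (x : ℝ) ^ (2 * n)

theorem evenMoment_eq_free_add_frozen (hα : α ∈ Set.Ioo (0 : ℝ) 1) (h : IsSymmProb m) (n : ℕ) :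
    evenMoment m n = evenMoment (free α m) n + evenMoment (frozen α m) n := by
  unfold evenMoment
  rw [← (summable_mul_of_finite_support (finite_support_free hα h) _).tsum_add
    (summable_mul_of_finite_support (finite_support_frozen hα h) _)]
  exact tsum_congr fun x => by unfold free; ring

theorem evenMoment_free_zero (h : IsSymmProb m) : evenMoment (free α m) 0 = 1 - α := by
  simpa [evenMoment] using (hasSum_free α h).tsum_eq

theorem evenMoment_free_nonneg (hα : α ∈ Set.Ioo (0 : ℝ) 1) (h : IsSymmProb m) (n : ℕ) :
    0 ≤ evenMoment (free α m) n :=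
  tsum_nonneg fun x => mul_nonneg (free_nonneg hα h x) ((even_two_mul n).pow_nonneg _)

/-- A pointwise comparison on the support of a nonnegative mass distribution can be integrated. -/
theorem tsum_mul_le_of_support {f g : ℤ → ℝ} (hm : (Function.support m).Finite)
    (h0 : ∀ x, 0 ≤ m x) (h : ∀ x, m x ≠ 0 → f x ≤ g x) :
    ∑' x, m x * f x ≤ ∑' x, m x * g x := by
  refine (summable_mul_of_finite_support hm f).tsum_le_tsum (fun x => ?_)
    (summable_mul_of_finite_support hm g)
  by_cases hx : m x = 0
  · simp [hx]
  · exact mul_le_mul_of_nonneg_left (h x hx) (h0 x)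

theorem even_pow_le_of_abs_le {x b : ℤ} (n : ℕ) (h : |x| ≤ b) :
    (x : ℝ) ^ (2 * n) ≤ (b : ℝ) ^ (2 * n) := by
  rw [← (even_two_mul n).pow_abs]
  exact pow_le_pow_left₀ (abs_nonneg _) (by exact_mod_cast h) _

theorem evenMoment_free_le (hα : α ∈ Set.Ioo (0 : ℝ) 1) (h : IsSymmProb m) (n : ℕ) :
    evenMoment (free α m) n ≤ (1 - α) * (boundary α m : ℝ) ^ (2 * n) := by
  rw [← (hasSum_free α h).tsum_eq, ← tsum_mul_right]
  exact tsum_mul_le_of_support (finite_support_free hα h) (free_nonneg hα h) fun x hx =>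
    even_pow_le_of_abs_le n (abs_le_boundary_of_free_ne_zero hα h hx)

theorem le_evenMoment_frozen (hα : α ∈ Set.Ioo (0 : ℝ) 1) (h : IsSymmProb m) (n : ℕ) :
    α * (boundary α m : ℝ) ^ (2 * n) ≤ evenMoment (frozen α m) n := by
  have e : α * (boundary α m : ℝ) ^ (2 * n)
      = ∑' x, frozen α m x * (boundary α m : ℝ) ^ (2 * n) := by
    rw [tsum_mul_right, (hasSum_frozen α h).tsum_eq]
  rw [e]
  refine tsum_mul_le_of_support (finite_support_frozen hα h) (frozen_nonneg hα h) fun x hx => ?_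
  rw [← (even_two_mul n).pow_abs (x : ℝ)]
  exact pow_le_pow_left₀ (by exact_mod_cast boundary_nonneg hα h)
    (by exact_mod_cast boundary_le_abs_of_frozen_ne_zero hx) _

theorem evenMoment_frozen_mu_le (hα : α ∈ Set.Ioo (0 : ℝ) 1) (t n : ℕ) :
    evenMoment (frozen α (mu α t)) n ≤ α * ((beta α t : ℝ) + 1) ^ (2 * n) := by
  have h := isSymmProb_mu hα t
  have e : α * ((beta α t : ℝ) + 1) ^ (2 * n)
      = ∑' x, frozen α (mu α t) x * ((beta α t : ℝ) + 1) ^ (2 * n) := by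
    rw [tsum_mul_right, (hasSum_frozen α h).tsum_eq]
  rw [e]
  refine tsum_mul_le_of_support (finite_support_frozen hα h) (frozen_nonneg hα h) fun x hx => ?_
  have h1 : mu α t x ≠ 0 := fun hm =>
    hx (le_antisymm ((frozen_le hα h x).trans_eq hm) (frozen_nonneg hα h x))
  have h2 := even_pow_le_of_abs_le n (abs_le_beta_add_one hα t h1)
  exact_mod_cast h2

theorem sqrt_natCast_pow (t n : ℕ) : √(t : ℝ) ^ (2 * n) = (t : ℝ) ^ n := by
  rw [pow_mul, Real.sq_sqrt (Nat.cast_nonneg t)]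

theorem tendsto_sqrt_natCast : Tendsto (fun t : ℕ => √(t : ℝ)) atTop atTop :=
  Real.tendsto_sqrt_atTop.comp tendsto_natCast_atTop_atTop

variable {l : ℝ}

theorem tendsto_beta_add_one_div
    (hl : Tendsto (fun t : ℕ => (beta α t : ℝ) / √(t : ℝ)) atTop (𝓝 l)) :
    Tendsto (fun t : ℕ => ((beta α t : ℝ) + 1) / √(t : ℝ)) atTop (𝓝 l) := by
  have h := hl.add (tendsto_sqrt_natCast.const_div_atTop 1)
  rw [add_zero] at h
  exact h.congr fun t => by ring

theorem tendsto_evenMoment_frozen (hα : α ∈ Set.Ioo (0 : ℝ) 1)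
    (hl : Tendsto (fun t : ℕ => (beta α t : ℝ) / √(t : ℝ)) atTop (𝓝 l)) (n : ℕ) :
    Tendsto (fun t : ℕ => evenMoment (frozen α (mu α t)) n / (t : ℝ) ^ n) atTop
      (𝓝 (α * l ^ (2 * n))) := by
  refine tendsto_of_tendsto_of_tendsto_of_le_of_le ((hl.pow (2 * n)).const_mul α)
    (((tendsto_beta_add_one_div hl).pow (2 * n)).const_mul α) (fun t => ?_) (fun t => ?_)
  · simp only [div_pow, sqrt_natCast_pow, ← mul_div_assoc]
    exact div_le_div_of_nonneg_right (le_evenMoment_frozen hα (isSymmProb_mu hα t) n)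
      (by positivity)
  · simp only [div_pow, sqrt_natCast_pow, ← mul_div_assoc]
    exact div_le_div_of_nonneg_right (evenMoment_frozen_mu_le hα t n) (by positivity)

/-- The increment of the moment of order `2 n + 2` is governed by the free moment of order `2 n`:
the free mass lives on a scale `√t`, where the second difference of `x ^ (2 n + 2)` is
`(n + 1) (2 n + 1) x ^ (2 n)` with a relative error `O(1 / √t)`. -/
theorem tendsto_evenMoment_mu_diff (hα : α ∈ Set.Ioo (0 : ℝ) 1)
    (hl : Tendsto (fun t : ℕ => (beta α t : ℝ) / √(t : ℝ)) atTop (𝓝 l)) {n : ℕ} {c : ℝ}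
    (hc : Tendsto (fun t : ℕ => evenMoment (free α (mu α t)) n / (t : ℝ) ^ n) atTop (𝓝 c)) :
    Tendsto (fun t : ℕ => (evenMoment (mu α (t + 1)) (n + 1) - evenMoment (mu α t) (n + 1))
      / (t : ℝ) ^ n) atTop (𝓝 ((n + 1) * (2 * n + 1) * c)) := by
  have hl0 : 0 ≤ l := ge_of_tendsto' hl fun t =>
    div_nonneg (by exact_mod_cast boundary_nonneg hα (isSymmProb_mu hα t)) (Real.sqrt_nonneg _)
  obtain ⟨K, hK⟩ := exists_abs_second_diff_sub_le (2 * n) (R := l + 1) (by linarith)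
  have herr : Tendsto (fun t : ℕ => (1 - α) * K / √(t : ℝ)) atTop (𝓝 0) :=
    tendsto_sqrt_natCast.const_div_atTop _
  have hzero : Tendsto (fun t : ℕ => (evenMoment (mu α (t + 1)) (n + 1)
      - evenMoment (mu α t) (n + 1)) / (t : ℝ) ^ n
      - (n + 1) * (2 * n + 1) * (evenMoment (free α (mu α t)) n / (t : ℝ) ^ n)) atTop (𝓝 0) := by
    refine squeeze_zero_norm' ?_ herr
    filter_upwards [eventually_ge_atTop 1, hl.eventually (ge_mem_nhds (lt_add_one l))]
      with t ht hbt
    have h := isSymmProb_mu hα t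
    have hfin := finite_support_free hα h
    have ht' : (1 : ℝ) ≤ t := by exact_mod_cast ht
    have hs : 1 ≤ √(t : ℝ) := Real.one_le_sqrt.2 ht'
    have hs0 : 0 < √(t : ℝ) := by linarith
    rw [div_le_iff₀ hs0] at hbt
    set G : ℤ → ℝ := fun x => (((x : ℝ) + 1) ^ (2 * n + 2) + ((x : ℝ) - 1) ^ (2 * n + 2)) / 2
      - (x : ℝ) ^ (2 * n + 2) - (n + 1) * (2 * n + 1) * (x : ℝ) ^ (2 * n)
    have e1 : evenMoment (mu α (t + 1)) (n + 1) - evenMoment (mu α t) (n + 1)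
        - (n + 1) * (2 * n + 1) * evenMoment (free α (mu α t)) n
        = ∑' x, free α (mu α t) x * G x := by
      have e := tsum_step_mul hα h fun x : ℤ => (x : ℝ) ^ (2 * (n + 1))
      unfold evenMoment
      rw [mu, e, add_sub_cancel_left, ← tsum_mul_left,
        ← (summable_mul_of_finite_support hfin _).tsum_sub
          ((summable_mul_of_finite_support hfin _).mul_left _)]
      refine tsum_congr fun x => ?_
      simp only [G]
      push_cast
      ring
    have hG : ∀ x, free α (mu α t) x ≠ 0 → |G x| ≤ K * √(t : ℝ) ^ (2 * n) / √(t : ℝ) := by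
      intro x hx
      have h1 : |x| ≤ beta α t := abs_le_boundary_of_free_ne_zero hα h hx
      have h2 : |(x : ℝ)| ≤ beta α t := by exact_mod_cast h1
      have h3 := hK (√(t : ℝ)) x hs (h2.trans hbt)
      have h4 : ((2 * n : ℕ) + 2 : ℝ) * ((2 * n : ℕ) + 1) / 2 = (n + 1) * (2 * n + 1) := by
        push_cast
        ring
      rwa [h4] at h3
    have e2 : |∑' x, free α (mu α t) x * G x|
        ≤ (1 - α) * (K * √(t : ℝ) ^ (2 * n) / √(t : ℝ)) := by
      rw [← (hasSum_free α h).tsum_eq, ← tsum_mul_right, abs_le, ← tsum_neg]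
      constructor
      · simp only [← mul_neg]
        exact tsum_mul_le_of_support hfin (free_nonneg hα h) fun x hx => (abs_le.1 (hG x hx)).1
      · exact tsum_mul_le_of_support hfin (free_nonneg hα h) fun x hx => (abs_le.1 (hG x hx)).2
    rw [← mul_div_assoc, ← sub_div, e1, norm_div, Real.norm_eq_abs,
      Real.norm_of_nonneg (by positivity), div_le_iff₀ (by positivity)]
    rw [sqrt_natCast_pow] at e2
    exact e2.trans_eq (by ring)
  have := hzero.add (hc.const_mul ((n + 1) * (2 * n + 1) : ℝ))
  rw [zero_add] at this
  exact this.congr fun t => by ring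

/-- The total moment of order `2 n + 2` grows like `(2 n + 1) c t ^ (n + 1)`; subtracting its frozen
part leaves the free moment. -/
theorem tendsto_evenMoment_free_succ (hα : α ∈ Set.Ioo (0 : ℝ) 1)
    (hl : Tendsto (fun t : ℕ => (beta α t : ℝ) / √(t : ℝ)) atTop (𝓝 l)) {n : ℕ} {c : ℝ}
    (hc : Tendsto (fun t : ℕ => evenMoment (free α (mu α t)) n / (t : ℝ) ^ n) atTop (𝓝 c)) :
    Tendsto (fun t : ℕ => evenMoment (free α (mu α t)) (n + 1) / (t : ℝ) ^ (n + 1)) atTop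
      (𝓝 ((2 * n + 1) * c - α * l ^ (2 * n + 2))) := by
  have h1 := tendsto_div_pow_of_tendsto_diff (a := fun t => evenMoment (mu α t) (n + 1))
    (tendsto_evenMoment_mu_diff hα hl hc)
  have h2 := h1.sub (tendsto_evenMoment_frozen hα hl (n + 1))
  have hn : (n : ℝ) + 1 ≠ 0 := by positivity
  have e : ((n + 1) * (2 * n + 1) * c : ℝ) / (n + 1) = (2 * n + 1) * c := by field_simp
  rw [e] at h2
  refine h2.congr fun t => ?_
  rw [← sub_div, evenMoment_eq_free_add_frozen hα (isSymmProb_mu hα t), add_sub_cancel_right]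

/-- The rescaled even moments of the free mass converge, and their limits satisfy the moment
recursion with end point `lim β_t / √t`. -/
theorem exists_isMomentSeq (hα : α ∈ Set.Ioo (0 : ℝ) 1)
    (hl : Tendsto (fun t : ℕ => (beta α t : ℝ) / √(t : ℝ)) atTop (𝓝 l)) :
    ∃ c, IsMomentSeq α l c ∧ ∀ n, Tendsto
      (fun t : ℕ => evenMoment (free α (mu α t)) n / (t : ℝ) ^ n) atTop (𝓝 (c n)) := by
  have hzero : Tendsto (fun t : ℕ => evenMoment (free α (mu α t)) 0 / (t : ℝ) ^ 0) atTop
      (𝓝 (1 - α)) := by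
    simp [evenMoment_free_zero (isSymmProb_mu hα _)]
  have hex : ∀ n, ∃ c, Tendsto
      (fun t : ℕ => evenMoment (free α (mu α t)) n / (t : ℝ) ^ n) atTop (𝓝 c) := by
    intro n
    induction n with
    | zero => exact ⟨_, hzero⟩
    | succ n ih => exact ⟨_, tendsto_evenMoment_free_succ hα hl ih.choose_spec⟩
  choose c hc using hex
  refine ⟨c, ⟨tendsto_nhds_unique (hc 0) hzero, fun n => ?_, fun n => ?_, fun n => ?_⟩, hc⟩
  · exact tendsto_nhds_unique (hc (n + 1)) (tendsto_evenMoment_free_succ hα hl (hc n))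
  · exact ge_of_tendsto' (hc n) fun t =>
      div_nonneg (evenMoment_free_nonneg hα (isSymmProb_mu hα t) n) (by positivity)
  · refine le_of_tendsto_of_tendsto' (hc n) ((hl.pow (2 * n)).const_mul (1 - α)) fun t => ?_
    rw [div_pow, sqrt_natCast_pow, ← mul_div_assoc]
    exact div_le_div_of_nonneg_right (evenMoment_free_le hα (isSymmProb_mu hα t) n) (by positivity)

/-! ### Moments of the rescaled measures and of the limit -/

theorem integral_rescaled (hα : α ∈ Set.Ioo (0 : ℝ) 1) (t : ℕ) {f : ℝ → ℝ} (hf : Continuous f) :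
    ∫ x, f x ∂(rescaled α hα t : Measure ℝ) = ∑' x : ℤ, mu α t x * f (x / √(t : ℝ)) := by
  have h := isSymmProb_mu hα t
  have hm : muMeasure α t =
      ∑ x ∈ h.finite.toFinset, ENNReal.ofReal (mu α t x) • Measure.dirac x := by
    ext s hs
    rw [muMeasure, Measure.sum_apply _ hs, Measure.finsetSum_apply]
    refine tsum_eq_sum fun x hx => ?_
    have : mu α t x = 0 := by simpa using hx
    simp [this]
  change ∫ x, f x ∂((muMeasure α t).map fun x : ℤ => (x : ℝ) / √(t : ℝ)) = _
  rw [integral_map (by fun_prop) hf.aestronglyMeasurable, hm, integral_finsetSum_measure]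
  · rw [tsum_eq_sum (s := h.finite.toFinset)]
    · refine Finset.sum_congr rfl fun x _ => ?_
      rw [integral_smul_measure, integral_dirac, ENNReal.toReal_ofReal (h.nonneg x), smul_eq_mul]
    · intro x hx
      have : mu α t x = 0 := by simpa using hx
      simp [this]
  · exact fun x _ => (integrable_dirac (by simp)).smul_measure ENNReal.ofReal_ne_top

theorem ae_rescaled_of_forall (hα : α ∈ Set.Ioo (0 : ℝ) 1) (t : ℕ) {s : Set ℝ}
    (hs : MeasurableSet s) (h : ∀ x : ℤ, mu α t x ≠ 0 → (x : ℝ) / √(t : ℝ) ∈ s) :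
    ∀ᵐ x ∂(rescaled α hα t : Measure ℝ), x ∈ s := by
  change ∀ᵐ x ∂((muMeasure α t).map fun x : ℤ => (x : ℝ) / √(t : ℝ)), x ∈ s
  refine (ae_map_iff (by fun_prop) hs).2 ?_
  rw [muMeasure, Measure.ae_sum_iff]
  intro x
  by_cases hx : mu α t x = 0
  · simp [hx]
  · refine Measure.ae_smul_measure ?_ _
    rw [ae_dirac_eq]
    exact h x hx

theorem integral_rescaled_even (hα : α ∈ Set.Ioo (0 : ℝ) 1) (t n : ℕ) :
    ∫ x, x ^ (2 * n) ∂(rescaled α hα t : Measure ℝ) = evenMoment (mu α t) n / (t : ℝ) ^ n := by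
  rw [integral_rescaled hα t (by fun_prop), evenMoment, ← tsum_div_const]
  exact tsum_congr fun x => by rw [div_pow, sqrt_natCast_pow, mul_div_assoc]

theorem integral_rescaled_odd (hα : α ∈ Set.Ioo (0 : ℝ) 1) (t n : ℕ) :
    ∫ x, x ^ (2 * n + 1) ∂(rescaled α hα t : Measure ℝ) = 0 := by
  rw [integral_rescaled hα t (by fun_prop)]
  have h := isSymmProb_mu hα t
  have e := (Equiv.neg ℤ).tsum_eq fun x : ℤ => mu α t x * ((x : ℝ) / √(t : ℝ)) ^ (2 * n + 1)
  have e' : ∀ x : ℤ, mu α t (Equiv.neg ℤ x) * ((Equiv.neg ℤ x : ℤ) / √(t : ℝ)) ^ (2 * n + 1)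
      = -(mu α t x * ((x : ℝ) / √(t : ℝ)) ^ (2 * n + 1)) := fun x => by
    rw [Equiv.neg_apply, h.symm, Int.cast_neg, neg_div, Odd.neg_pow ⟨n, rfl⟩, mul_neg]
  rw [tsum_congr e', tsum_neg] at e
  linarith

theorem integrable_truncGauss {q : ℝ} {f : ℝ → ℝ} (hf : Continuous f) (hq : 0 < q) :
    Integrable f (truncGauss q) := by
  refine Integrable.smul_measure hf.integrableOn_Icc (ENNReal.inv_ne_top.2 fun h0 => ?_)
  have h1 := gauss_real_Icc hq
  rw [Measure.real, h0] at h1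
  exact (mul_pos (by positivity) (gaussMoment_zero_pos hq)).ne h1

theorem integral_limitMeasure (hα : α ∈ Set.Ioo (0 : ℝ) 1) {q : ℝ} (hq : 0 < q) {f : ℝ → ℝ}
    (hf : Continuous f) : ∫ x, f x ∂limitMeasure α q =
      α / 2 * f (-q) + (1 - α) * ((∫ x in -q..q, f x * Real.exp (-x ^ 2 / 2)) / gaussMoment q 0)
        + α / 2 * f q := by
  obtain ⟨h0, h1⟩ := hα
  have hd : ∀ a b : ℝ, Integrable f (ENNReal.ofReal b • Measure.dirac a) := fun a b =>
    (integrable_dirac (by simp)).smul_measure ENNReal.ofReal_ne_top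
  have ht := (integrable_truncGauss hf hq).smul_measure (ENNReal.ofReal_ne_top (r := 1 - α))
  rw [limitMeasure, integral_add_measure ((hd _ _).add_measure ht) (hd _ _),
    integral_add_measure (hd _ _) ht, integral_smul_measure, integral_smul_measure,
    integral_smul_measure, integral_dirac, integral_dirac, integral_truncGauss hq,
    ENNReal.toReal_ofReal (by linarith), ENNReal.toReal_ofReal (by linarith)]
  simp only [smul_eq_mul]

theorem integral_limitMeasure_even (hα : α ∈ Set.Ioo (0 : ℝ) 1) {q : ℝ} (hq : 0 < q) (n : ℕ) :
    ∫ x, x ^ (2 * n) ∂limitMeasure α q =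
      (1 - α) * (gaussMoment q n / gaussMoment q 0) + α * q ^ (2 * n) := by
  rw [integral_limitMeasure hα hq (by fun_prop), (even_two_mul n).neg_pow, ← gaussMoment]
  ring

theorem integral_limitMeasure_odd (hα : α ∈ Set.Ioo (0 : ℝ) 1) {q : ℝ} (hq : 0 < q) (n : ℕ) :
    ∫ x, x ^ (2 * n + 1) ∂limitMeasure α q = 0 := by
  have hodd : ∀ x : ℝ, (-x) ^ (2 * n + 1) = -x ^ (2 * n + 1) := Odd.neg_pow ⟨n, rfl⟩
  have e := intervalIntegral.integral_comp_neg (a := -q) (b := q)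
    fun x : ℝ => x ^ (2 * n + 1) * Real.exp (-x ^ 2 / 2)
  simp only [hodd, neg_sq, neg_neg, neg_mul, intervalIntegral.integral_neg] at e
  rw [integral_limitMeasure hα hq (by fun_prop), hodd,
    (by linarith : ∫ x in -q..q, x ^ (2 * n + 1) * Real.exp (-x ^ 2 / 2) = 0)]
  ring

theorem ae_limitMeasure_mem_Icc {q R : ℝ} (hq : 0 < q) (hR : q ≤ R) :
    ∀ᵐ x ∂limitMeasure α q, x ∈ Set.Icc (-R) R := by
  have hsub : Set.Icc (-q) q ⊆ Set.Icc (-R) R := Set.Icc_subset_Icc (by linarith) hR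
  simp only [limitMeasure, ae_add_measure_iff]
  refine ⟨⟨Measure.ae_smul_measure ?_ _, Measure.ae_smul_measure ?_ _⟩,
    Measure.ae_smul_measure ?_ _⟩
  · rw [ae_dirac_eq]
    exact hsub (Set.left_mem_Icc.2 (by linarith))
  · refine Measure.ae_smul_measure ?_ _
    exact (ae_restrict_mem measurableSet_Icc).mono fun x hx => hsub hx
  · rw [ae_dirac_eq]
    exact hsub (Set.right_mem_Icc.2 (by linarith))

/-- Comparing the moment recursions of the free mass and of `(1 - α) Φ_q` gives `l = q`, after which
the moments agree. -/
theorem tendsto_rescaled_limit (hα : α ∈ Set.Ioo (0 : ℝ) 1) {q : ℝ} (hq : 0 < q)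
    (hT : TruncEq α q) (hl : Tendsto (fun t : ℕ => (beta α t : ℝ) / √(t : ℝ)) atTop (𝓝 l)) :
    Tendsto (fun t : ℕ => rescaled α hα t) atTop (𝓝 (limit α q hα hq)) := by
  have hl0 : 0 ≤ l := ge_of_tendsto' hl fun t =>
    div_nonneg (by exact_mod_cast boundary_nonneg hα (isSymmProb_mu hα t)) (Real.sqrt_nonneg _)
  obtain ⟨c, hc, hlim⟩ := exists_isMomentSeq hα hl
  have hg := isMomentSeq_gauss hα.2 hq hT
  obtain rfl : l = q := hc.endpoint_eq hα.1 hl0 hq.le hg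
  refine tendsto_of_moments (R := l + 1) ?_ (ae_limitMeasure_mem_Icc hq (by linarith)) fun k => ?_
  · filter_upwards [(tendsto_beta_add_one_div hl).eventually (ge_mem_nhds (lt_add_one l))] with t ht
    refine ae_rescaled_of_forall hα t measurableSet_Icc fun x hx => ?_
    have h1 := abs_le_beta_add_one hα t hx
    have h2 : |(x : ℝ)| ≤ beta α t + 1 := by exact_mod_cast h1
    rw [Set.mem_Icc, ← abs_le, abs_div, abs_of_nonneg (Real.sqrt_nonneg _)]
    exact (div_le_div_of_nonneg_right h2 (Real.sqrt_nonneg _)).trans ht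
  · change Tendsto _ _ (𝓝 (∫ x, x ^ k ∂limitMeasure α l))
    rcases Nat.even_or_odd' k with ⟨n, rfl | rfl⟩
    · rw [integral_limitMeasure_even hα hq, ← hc.eq hg n]
      refine ((hlim n).add (tendsto_evenMoment_frozen hα hl n)).congr fun t => ?_
      rw [integral_rescaled_even, ← add_div,
        ← evenMoment_eq_free_add_frozen hα (isSymmProb_mu hα t)]
    · simp only [integral_rescaled_odd, integral_limitMeasure_odd hα hq]
      exact tendsto_const_nhds

end FBD

end

theorem theorem1 (α : ℝ) (hα : α ∈ Set.Ioo (0 : ℝ) 1) :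
    (∃! q : ℝ, 0 < q ∧ FBD.TruncEq α q) ∧
    ∀ (q : ℝ) (hq : 0 < q), FBD.TruncEq α q →
      (∃ l : ℝ, Tendsto (fun t : ℕ => (FBD.beta α t : ℝ) / √(t : ℝ)) atTop (𝓝 l)) →
        Tendsto (fun t : ℕ => FBD.rescaled α hα t) atTop (𝓝 (FBD.limit α q hα hq)) := by
  refine ⟨?_, fun q hq hT ⟨l, hl⟩ => FBD.tendsto_rescaled_limit hα hq hT hl⟩
  obtain ⟨q, hq, hT⟩ := FBD.exists_truncEq hα
  refine ⟨q, ⟨hq, hT⟩, fun q' ⟨hq', hT'⟩ => ?_⟩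
  exact (FBD.isMomentSeq_gauss hα.2 hq' hT').endpoint_eq hα.1 hq'.le hq.le
    (FBD.isMomentSeq_gauss hα.2 hq hT)
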